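/- **Setting.** Let $\phi:\mathbb R\to[0,\infty)$ and $\psi:\mathbb R^2\to[0,\infty)$ be smooth and not identically zero, with $\phi$ supported in $[0,1]$, $\psi$ supported in $\{|x|\le 1/2\}$ and $\psi(-x)=\psi(x)$. Let $$R(s,y)=(\phi\star\tilde\phi)(s)\,(\psi\star\psi)(y),\qquad \tilde\phi(s)=\phi(-s).$$ Let $B$ be a standard Brownian motion in $\mathbb R^2$ started at $0$, and let $B^1,B^2$ be independent copies of $B$. For $\hat\beta>0$, $0<\epsilon<1$ and $T>0$ put $$\zeta^{(\epsilon)}_T=\log \mathbb E_B\Big[\exp\Big(\frac{\hat\beta^2}{2\log\frac1\epsilon}\int_{[0,T]^2}R(s-u,B(s)-B(u))\,ds\,du\Big)\Big],$$ and let $$C_1=\frac{\hat\beta^2}{2}\,\mathbb E_B\Big[\int_{[0,1]^2}R(s-u,B(s)-B(u))\,ds\,du\Big]+\hat\beta^2\,\mathbb E_{B^1}\mathbb E_{B^2}\Big[\int_{[0,1]^2}R\big(1+s-u,\;B^1(1)+B^2(s)-B^1(u)\big)\,ds\,du\Big].$$ **Lemma.** One has $C_1>0$, and for every $t>0$, as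 $\epsilon\to0$, $$\zeta^{(\epsilon)}_{t/\epsilon^2}=(C_1+o(1))\,\frac{t}{\epsilon^2\log\frac1\epsilon}+o(1).$$ The error terms depend only on $R$, in the following sense. For every $M>0$ (for example $M=\hat\beta_c(R)=\sqrt{2\pi/\|R\|_1}$) there is a function $\delta$ of $\epsilon$, depending only on $R$ and $M$, with $\delta(\epsilon)\to0$ as $\epsilon\to0^+$, such that for all $\hat\beta\in(0,M]$, all $t>0$ and all $\epsilon\in(0,1)$ both error terms are at most $\delta(\epsilon)$ in absolute value. -/

import Mathlib

open MeasureTheory ProbabilityTheory Set Filter Topology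
open scoped NNReal ContDiff Convolution

noncomputable section

/-- The plane `ℝ²` with its Euclidean norm. -/
abbrev Plane : Type := EuclideanSpace ℝ (Fin 2)

/-- The correlation function of the smoothed noise
`V(t,x) = ∫ φ(t - s) ψ(x - y) dξ(s,y)`:
`R(s,y) = (φ ⋆ φ~)(s) * (ψ ⋆ ψ)(y)` with `φ~(s) = φ(-s)`. -/
def noiseCorr (φ : ℝ → ℝ) (ψ : Plane → ℝ) (s : ℝ) (y : Plane) : ℝ :=
  (φ ⋆[ContinuousLinearMap.mul ℝ ℝ, volume] (fun r : ℝ => φ (-r))) s *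
    (ψ ⋆[ContinuousLinearMap.mul ℝ ℝ, volume] ψ) y

/-- `B` is a standard planar Brownian motion started at `0` on the probability space `(Ω, P)`:
its two coordinates are independent standard real Brownian motions. -/
structure IsPlanarBrownian {Ω : Type*} [MeasurableSpace Ω] (B : ℝ≥0 → Ω → Plane)
    (P : Measure Ω) : Prop where
  coord : ∀ i : Fin 2, IsBrownianReal (fun t η => B t η i) P
  indep : iIndepFun (fun (i : Fin 2) (η : Ω) (t : ℝ≥0) => B t η i) P

/-- The self-interaction `∫_{[0,T]²} R(s - u, w(s) - w(u)) ds du` of a path `w`. -/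
def selfInteraction (R : ℝ → Plane → ℝ) (T : ℝ) (w : ℝ≥0 → Plane) : ℝ :=
  ∫ p in Icc (0 : ℝ) T ×ˢ Icc (0 : ℝ) T,
    R (p.1 - p.2) (w p.1.toNNReal - w p.2.toNNReal)

/-- The interaction of two consecutive unit segments: the segment `x` is run during `[0,1]` and
the segment `y`, started from `x(1)`, is run during `[1,2]`. It is
`∫_{[0,1]²} R(1 + s - u, x(1) + y(s) - x(u)) ds du`, where the times of the two points
are `1 + s` and `u`. -/
def neighbourInteraction (R : ℝ → Plane → ℝ) (x y : ℝ≥0 → Plane) : ℝ :=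
  ∫ p in Icc (0 : ℝ) 1 ×ˢ Icc (0 : ℝ) 1,
    R (1 + p.1 - p.2) (x 1 + y p.1.toNNReal - x p.2.toNNReal)

/-- The normalisation constant
`ζ_T^{(ε)} = log E exp( β² / (2 log(1/ε)) ∫_{[0,T]²} R(s - u, B(s) - B(u)) ds du )`. -/
def zetaConst {Ω : Type*} [MeasurableSpace Ω] (R : ℝ → Plane → ℝ) (β : ℝ)
    (B : ℝ≥0 → Ω → Plane) (P : Measure Ω) (ε T : ℝ) : ℝ :=
  Real.log (∫ η, Real.exp (β ^ 2 / (2 * Real.log (1 / ε)) *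
    selfInteraction R T (fun t => B t η)) ∂P)

/-- The constant `C₁ = (β²/2) E[self-interaction of B on [0,1]]
+ β² E_{B¹} E_{B²}[interaction of two neighbouring independent segments B¹, B²]`. -/
def leadingConst {Ω : Type*} [MeasurableSpace Ω] (R : ℝ → Plane → ℝ) (β : ℝ)
    (B : ℝ≥0 → Ω → Plane) (P : Measure Ω) : ℝ :=
  β ^ 2 / 2 * (∫ η, selfInteraction R 1 (fun t => B t η) ∂P) +
    β ^ 2 * ∫ η₁, ∫ η₂, neighbourInteraction R (fun t => B t η₁) (fun t => B t η₂) ∂P ∂P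

end

/-! Write `c = β² / log (1/ε)`, `T = t / ε²`, and let `S_T` be the self-interaction on `[0,T]`; the
quantity to estimate is `log E exp (c/2 · S_T)`. Since `R` vanishes at time lags of size at least
`1`, cutting `[0,N]²` into unit cells leaves only diagonal and adjacent ones
(`selfInteraction_natCast`). The unit increments of Brownian motion are i.i.d., so `E S_N = N a + 2
(N - 1) b`, where `a` is the mean self-interaction of one segment and `b` that of two neighbours.
The rate `m = a/2 + b` is `leadingConst` at `β = 1`, and `C₁ = β² m`.

Lower bound (`le_logMoment`): Jensen's inequality gives `c/2 · E S_T`, which is `c T m` up to a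
boundary term `O(c)`.

Upper bound (`logMoment_le`): `S_T` is at most twice a sum of bounded functions of consecutive
segments. Separating even and odd pairs makes the summands independent, at the price of doubling
`c`; then `E exp (2 c h) ≤ 1 + 2 c m + O(c²)` for each pair, and about `T/2` pairs give `c T m +
O(c² T) + O(c)`.

As `c T = β² t / (ε² log (1/ε))`, the `c² T` error is a factor `O(1 / log (1/ε))` times `t / (ε² log
(1/ε))`, and the boundary error tends to `0`. Both are monotone in `c` and depend otherwise only on
an upper bound `K` of `R`, which gives uniformity for `β ≤ M` and in `t`. -/

/-! ### Properties of the correlation kernel. -/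

/-- The properties of a correlation function `R` that the free energy estimate uses: it is
continuous, takes values in `[0, K]`, vanishes at time lags `≥ 1`, is even, and is positive at
the origin. -/
structure IsInteractionKernel (R : ℝ → Plane → ℝ) (K : ℝ) : Prop where
  cont : Continuous fun p : ℝ × Plane => R p.1 p.2
  nonneg : ∀ s y, 0 ≤ R s y
  le : ∀ s y, R s y ≤ K
  eq_zero : ∀ s y, 1 ≤ |s| → R s y = 0
  even : ∀ s y, R (-s) (-y) = R s y
  pos : 0 < R 0 0

theorem IsInteractionKernel.bound_nonneg {R : ℝ → Plane → ℝ} {K : ℝ}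
    (hR : IsInteractionKernel R K) : 0 ≤ K :=
  (hR.nonneg 0 0).trans (hR.le 0 0)

theorem convolution_mul_nonneg {G : Type*} [MeasurableSpace G] [AddGroup G] {μ : Measure G}
    {f g : G → ℝ} (hf : ∀ x, 0 ≤ f x) (hg : ∀ x, 0 ≤ g x) (x : G) :
    0 ≤ (f ⋆[ContinuousLinearMap.mul ℝ ℝ, μ] g) x :=
  integral_nonneg fun t => mul_nonneg (hf t) (hg _)

/-- Autocorrelation at lag `0` is positive. -/
theorem convolution_self_reflect_zero_pos {G : Type*} [NormedAddCommGroup G]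
    [MeasurableSpace G] [BorelSpace G] {μ : Measure G} [IsFiniteMeasureOnCompacts μ]
    [μ.IsOpenPosMeasure] {f g : G → ℝ} (hf : Continuous f) (hfc : HasCompactSupport f)
    (hne : f ≠ 0) (hg : ∀ x, g (-x) = f x) :
    0 < (f ⋆[ContinuousLinearMap.mul ℝ ℝ, μ] g) 0 := by
  have hcs : HasCompactSupport fun x => f x * f x := hfc.mul_right
  have hc : Continuous fun x => f x * f x := hf.mul hf
  have h : (f ⋆[ContinuousLinearMap.mul ℝ ℝ, μ] g) 0 = ∫ x, f x * f x ∂μ := by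
    simp [convolution_def, hg]
  obtain ⟨x, hx⟩ := Function.ne_iff.1 hne
  rw [h]
  exact hc.integral_pos_of_hasCompactSupport_nonneg_nonzero hcs
    (fun x => mul_self_nonneg _) (x := x) (mul_self_ne_zero.2 hx)

theorem exists_isInteractionKernel_noiseCorr {φ : ℝ → ℝ} {ψ : Plane → ℝ}
    (hφc : Continuous φ) (hφ_nonneg : ∀ s, 0 ≤ φ s) (hφ_ne : φ ≠ 0)
    (hφ_supp : Function.support φ ⊆ Icc 0 1)
    (hψc : Continuous ψ) (hψ_nonneg : ∀ x, 0 ≤ ψ x) (hψ_ne : ψ ≠ 0)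
    (hψ_symm : ∀ x, ψ (-x) = ψ x)
    (hψ_supp : Function.support ψ ⊆ Metric.closedBall 0 (1 / 2)) :
    ∃ K, IsInteractionKernel (noiseCorr φ ψ) K := by
  have hφcs : HasCompactSupport φ := .of_support_subset_isCompact isCompact_Icc hφ_supp
  have hψcs : HasCompactSupport ψ :=
    .of_support_subset_isCompact (isCompact_closedBall _ _) hψ_supp
  set φ' : ℝ → ℝ := fun r => φ (-r) with hφ'
  have hφ'c : Continuous φ' := by fun_prop
  have hφ'cs : HasCompactSupport φ' := hφcs.comp_homeomorph (Homeomorph.neg ℝ)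
  set F := φ ⋆[ContinuousLinearMap.mul ℝ ℝ, volume] φ' with hF
  set G := ψ ⋆[ContinuousLinearMap.mul ℝ ℝ, volume] ψ with hG
  have hFc : Continuous F :=
    hφ'cs.continuous_convolution_right _ hφc.locallyIntegrable hφ'c
  have hGc : Continuous G :=
    hψcs.continuous_convolution_right _ hψc.locallyIntegrable hψc
  obtain ⟨a, ha⟩ := hFc.bounded_above_of_compact_support (hφcs.convolution _ hφ'cs)
  obtain ⟨b, hb⟩ := hGc.bounded_above_of_compact_support (hψcs.convolution _ hψcs)
  have hF0 : ∀ s, 0 ≤ F s := convolution_mul_nonneg hφ_nonneg fun _ => hφ_nonneg _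
  have hG0 : ∀ y, 0 ≤ G y := convolution_mul_nonneg hψ_nonneg hψ_nonneg
  -- The support of a continuous function is open, so it lies in the interior of `[0,1]`. The strict
  -- inequalities make the convolution integrand vanish identically even at lag exactly `±1`.
  have hsupp : ∀ s, s ∉ Ioo (0 : ℝ) 1 → φ s = 0 := by
    have : Function.support φ ⊆ Ioo 0 1 := by
      rw [← interior_Icc]
      exact interior_maximal hφ_supp hφc.isOpen_support
    exact fun s hs => by_contra fun h => hs (this h)
  refine ⟨a * b, ⟨?_, fun s y => mul_nonneg (hF0 s) (hG0 y), fun s y => ?_, fun s y hs => ?_,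
    fun s y => ?_, ?_⟩⟩
  · exact (hFc.comp continuous_fst).mul (hGc.comp continuous_snd)
  · exact mul_le_mul ((le_abs_self _).trans (ha s)) ((le_abs_self _).trans (hb y)) (hG0 y)
      ((norm_nonneg _).trans (ha 0))
  · have : F s = 0 := by
      refine integral_eq_zero_of_ae (.of_forall fun t => ?_)
      by_cases ht : t ∈ Ioo (0 : ℝ) 1
      · have : φ (-(s - t)) = 0 := hsupp _ fun h => by
          rcases le_abs.1 hs with hs | hs <;> linarith [h.1, h.2, ht.1, ht.2]
        simp [hφ', this]
      · simp [hsupp t ht]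
    exact mul_eq_zero_of_left this _
  -- An autocorrelation is even by translation invariance, with no symmetry of `φ`; the spatial
  -- factor uses that `ψ` is even.
  · have h1 : F (-s) = F s := by
      simp only [hF, convolution_def, hφ', ContinuousLinearMap.mul_apply']
      rw [← integral_add_right_eq_self _ (-s)]
      congr 1 with t
      rw [show -(-s - (t + -s)) = t by ring, show -(s - t) = t + -s by ring, mul_comm]
    have h2 : G (-y) = G y := by
      simp only [hG, convolution_def, ContinuousLinearMap.mul_apply']
      rw [← integral_neg_eq_self]
      congr 1 with t
      rw [hψ_symm, ← hψ_symm (y - t)]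
      congr 2
      abel
    exact congr_arg₂ (· * ·) h1 h2
  · exact mul_pos (convolution_self_reflect_zero_pos hφc hφcs hφ_ne fun x => by simp)
      (convolution_self_reflect_zero_pos hψc hψcs hψ_ne hψ_symm)

/-! ### Path interactions: continuity, bounds, monotonicity, positivity. -/

/-- The increment of the path `w` after time `k`. -/
def shiftPath (w : ℝ≥0 → Plane) (k : ℝ≥0) (t : ℝ≥0) : Plane := w (k + t) - w k

theorem Continuous.shiftPath {w : ℝ≥0 → Plane} (hw : Continuous w) (k : ℝ≥0) :
    Continuous (shiftPath w k) :=
  (hw.comp (continuous_const.add continuous_id)).sub continuous_const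

namespace IsInteractionKernel

variable {R : ℝ → Plane → ℝ} {K : ℝ}

theorem continuous_pair (hR : IsInteractionKernel R K) {w : ℝ≥0 → Plane} (hw : Continuous w) :
    Continuous fun p : ℝ × ℝ => R (p.1 - p.2) (w p.1.toNNReal - w p.2.toNNReal) := by
  refine hR.cont.comp (f := fun p : ℝ × ℝ => (p.1 - p.2, w p.1.toNNReal - w p.2.toNNReal)) ?_
  have : Continuous Real.toNNReal := continuous_real_toNNReal
  fun_prop

theorem continuous_neighbour (hR : IsInteractionKernel R K) {x y : ℝ≥0 → Plane}
    (hx : Continuous x) (hy : Continuous y) :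
    Continuous fun p : ℝ × ℝ =>
      R (1 + p.1 - p.2) (x 1 + y p.1.toNNReal - x p.2.toNNReal) := by
  refine hR.cont.comp
    (f := fun p : ℝ × ℝ => (1 + p.1 - p.2, x 1 + y p.1.toNNReal - x p.2.toNNReal)) ?_
  have : Continuous Real.toNNReal := continuous_real_toNNReal
  fun_prop

end IsInteractionKernel

theorem setIntegral_prod_Icc_eq_intervalIntegral {g : ℝ × ℝ → ℝ} (hg : Continuous g)
    {a b c d : ℝ} (hab : a ≤ b) (hcd : c ≤ d) :
    ∫ p in Icc a b ×ˢ Icc c d, g p = ∫ s in a..b, ∫ u in c..d, g (s, u) := by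
  rw [Measure.volume_eq_prod, setIntegral_prod, intervalIntegral.integral_of_le hab,
    integral_Icc_eq_integral_Ioc]
  · simp_rw [intervalIntegral.integral_of_le hcd, integral_Icc_eq_integral_Ioc]
  · exact hg.continuousOn.integrableOn_compact (isCompact_Icc.prod isCompact_Icc)

theorem selfInteraction_nonneg {R : ℝ → Plane → ℝ} {K : ℝ} (hR : IsInteractionKernel R K)
    (T : ℝ) (w : ℝ≥0 → Plane) : 0 ≤ selfInteraction R T w :=
  integral_nonneg fun _ => hR.nonneg _ _

theorem neighbourInteraction_nonneg {R : ℝ → Plane → ℝ} {K : ℝ} (hR : IsInteractionKernel R K)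
    (x y : ℝ≥0 → Plane) : 0 ≤ neighbourInteraction R x y :=
  integral_nonneg fun _ => hR.nonneg _ _

theorem norm_setIntegral_prod_Icc_le {g : ℝ × ℝ → ℝ} {K T : ℝ} (hT : 0 ≤ T)
    (hg : ∀ p, |g p| ≤ K) : ‖∫ p in Icc 0 T ×ˢ Icc 0 T, g p‖ ≤ K * T ^ 2 := by
  have hv : (volume : Measure (ℝ × ℝ)).real (Icc 0 T ×ˢ Icc 0 T) = T ^ 2 := by
    rw [Measure.volume_eq_prod, measureReal_prod_prod, Real.volume_real_Icc, sub_zero,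
      max_eq_left hT, sq]
  rw [← hv]
  refine norm_setIntegral_le_of_norm_le_const ?_ fun p _ => hg p
  exact (isCompact_Icc.prod isCompact_Icc).measure_lt_top

theorem selfInteraction_le {R : ℝ → Plane → ℝ} {K : ℝ} (hR : IsInteractionKernel R K)
    {T : ℝ} (hT : 0 ≤ T) (w : ℝ≥0 → Plane) : selfInteraction R T w ≤ K * T ^ 2 :=
  (le_abs_self _).trans <| norm_setIntegral_prod_Icc_le hT fun _ => by
    rw [abs_of_nonneg (hR.nonneg _ _)]; exact hR.le _ _

theorem neighbourInteraction_le {R : ℝ → Plane → ℝ} {K : ℝ} (hR : IsInteractionKernel R K)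
    (x y : ℝ≥0 → Plane) : neighbourInteraction R x y ≤ K :=
  (le_abs_self _).trans <| (norm_setIntegral_prod_Icc_le zero_le_one fun _ => by
    rw [abs_of_nonneg (hR.nonneg _ _)]; exact hR.le _ _).trans_eq (by simp)

theorem selfInteraction_mono {R : ℝ → Plane → ℝ} {K : ℝ} (hR : IsInteractionKernel R K)
    {w : ℝ≥0 → Plane} (hw : Continuous w) {S T : ℝ} (hST : S ≤ T) :
    selfInteraction R S w ≤ selfInteraction R T w := by
  refine setIntegral_mono_set ?_ (.of_forall fun _ => hR.nonneg _ _) ?_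
  · exact (hR.continuous_pair hw).continuousOn.integrableOn_compact
      (isCompact_Icc.prod isCompact_Icc)
  · exact (prod_mono (Icc_subset_Icc_right hST) (Icc_subset_Icc_right hST)).eventuallyLE

/-- Interactions over `[0,1]` only depend on the paths up to time `1`. -/
theorem selfInteraction_one_congr {R : ℝ → Plane → ℝ} {w w' : ℝ≥0 → Plane}
    (h : ∀ t ≤ 1, ∀ s ≤ 1, w t - w s = w' t - w' s) :
    selfInteraction R 1 w = selfInteraction R 1 w' := by
  refine setIntegral_congr_fun (measurableSet_Icc.prod measurableSet_Icc) fun p hp => ?_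
  simp only [h _ (Real.toNNReal_le_one.2 hp.1.2) _ (Real.toNNReal_le_one.2 hp.2.2)]

theorem neighbourInteraction_congr {R : ℝ → Plane → ℝ} {x x' y y' : ℝ≥0 → Plane}
    (hx : ∀ t ≤ 1, x t = x' t) (hy : ∀ t ≤ 1, y t = y' t) :
    neighbourInteraction R x y = neighbourInteraction R x' y' := by
  refine setIntegral_congr_fun (measurableSet_Icc.prod measurableSet_Icc) fun p hp => ?_
  simp only [hx _ (Real.toNNReal_le_one.2 hp.2.2), hy _ (Real.toNNReal_le_one.2 hp.1.2),
    hx _ le_rfl]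

/-- On the diagonal the integrand equals `R 0 0 > 0`, so by continuity it is positive on a nonempty
open subset of the square, here around `(1/2, 1/2)`. -/
theorem selfInteraction_one_pos {R : ℝ → Plane → ℝ} {K : ℝ} (hR : IsInteractionKernel R K)
    {w : ℝ≥0 → Plane} (hw : Continuous w) : 0 < selfInteraction R 1 w := by
  have hc := hR.continuous_pair hw
  have hint := hc.continuousOn.integrableOn_compact (μ := volume)
    ((isCompact_Icc (a := (0 : ℝ)) (b := 1)).prod (isCompact_Icc (a := (0 : ℝ)) (b := 1)))
  rw [selfInteraction, setIntegral_pos_iff_support_of_nonneg_ae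
    (.of_forall fun _ => hR.nonneg _ _) hint]
  set U := Function.support fun p : ℝ × ℝ =>
    R (p.1 - p.2) (w p.1.toNNReal - w p.2.toNNReal)
  have hU : IsOpen U := hc.isOpen_support
  refine lt_of_lt_of_le (IsOpen.measure_pos volume
    (hU.inter ((isOpen_Ioo (a := (0 : ℝ)) (b := 1)).prod (isOpen_Ioo (a := (0 : ℝ)) (b := 1))))
    ⟨(1 / 2, 1 / 2), ?_, by norm_num⟩) (measure_mono ?_)
  · simpa [U] using hR.pos.ne'
  · exact inter_subset_inter_right _ (prod_mono Ioo_subset_Icc_self Ioo_subset_Icc_self)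

/-! ### Decomposition of the self-interaction into unit segments. -/

theorem sum_range_sum_range_tridiagonal {A : ℕ → ℕ → ℝ} (hsymm : ∀ i j, A i j = A j i)
    (hA : ∀ i j, j + 2 ≤ i → A i j = 0) (N : ℕ) :
    ∑ i ∈ Finset.range N, ∑ j ∈ Finset.range N, A i j =
      ∑ i ∈ Finset.range N, A i i + 2 * ∑ i ∈ Finset.range (N - 1), A (i + 1) i := by
  induction N with
  | zero => simp
  | succ N ih =>
    -- Below the diagonal, the new row has the single entry `A N (N - 1)`. Writing it as a
    -- difference of sums also covers `N = 0`, where there is none.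
    have h : ∑ j ∈ Finset.range N, A N j = ∑ i ∈ Finset.range N, A (i + 1) i -
        ∑ i ∈ Finset.range (N - 1), A (i + 1) i := by
      cases N with
      | zero => simp
      | succ M =>
        rw [Finset.sum_range_succ, Finset.sum_eq_zero fun j hj => hA _ _ ?_]
        · simp [Finset.sum_range_succ]
        · have := Finset.mem_range.1 hj; omega
    simp only [Finset.sum_range_succ, Finset.sum_add_distrib, ih, Nat.add_sub_cancel]
    simp only [hsymm _ N, h]
    ring

theorem intervalIntegral_intervalIntegral_nat_eq_sum {g : ℝ × ℝ → ℝ} (hg : Continuous g)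
    (N : ℕ) :
    ∫ s in (0 : ℝ)..N, ∫ u in (0 : ℝ)..N, g (s, u) =
      ∑ i ∈ Finset.range N, ∑ j ∈ Finset.range N,
        ∫ s in (0 : ℝ)..1, ∫ u in (0 : ℝ)..1, g (i + s, j + u) := by
  have key : ∀ f : ℝ → ℝ, Continuous f →
      ∫ s in (0 : ℝ)..N, f s = ∑ i ∈ Finset.range N, ∫ s in (0 : ℝ)..1, f (i + s) := by
    intro f hf
    have := intervalIntegral.sum_integral_adjacent_intervals (f := f) (μ := volume)
      (a := fun k : ℕ => (k : ℝ)) (n := N) fun k _ => hf.intervalIntegrable _ _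
    simp only [Nat.cast_zero] at this
    rw [← this]
    refine Finset.sum_congr rfl fun i _ => ?_
    rw [intervalIntegral.integral_comp_add_left]
    simp
  have hc : ∀ c d : ℝ, Continuous fun s => ∫ u in c..d, g (s, u) := fun c d =>
    intervalIntegral.continuous_parametric_intervalIntegral_of_continuous'
      (f := fun s u => g (s, u)) hg c d
  rw [key _ (hc _ _)]
  refine Finset.sum_congr rfl fun i _ => ?_
  rw [← intervalIntegral.integral_finsetSum]
  · refine intervalIntegral.integral_congr fun s _ => ?_
    exact key _ (hg.comp (Continuous.prodMk_right _))
  · intro j _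
    exact (intervalIntegral.continuous_parametric_intervalIntegral_of_continuous'
      (f := fun s u => g (i + s, j + u)) (by fun_prop) 0 1).intervalIntegrable _ _

/-- On an integer time interval only equal and adjacent unit segments interact. -/
theorem selfInteraction_natCast {R : ℝ → Plane → ℝ} {K : ℝ} (hR : IsInteractionKernel R K)
    {w : ℝ≥0 → Plane} (hw : Continuous w) (N : ℕ) :
    selfInteraction R N w =
      ∑ i ∈ Finset.range N, selfInteraction R 1 (shiftPath w i) +
      2 * ∑ i ∈ Finset.range (N - 1),
        neighbourInteraction R (shiftPath w i) (shiftPath w (i + 1)) := by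
  set g : ℝ × ℝ → ℝ := fun p => R (p.1 - p.2) (w p.1.toNNReal - w p.2.toNNReal) with hg
  have hgc : Continuous g := hR.continuous_pair hw
  set A : ℕ → ℕ → ℝ := fun i j =>
    ∫ s in (0 : ℝ)..1, ∫ u in (0 : ℝ)..1, g (i + s, j + u) with hA
  have hgsymm : ∀ s u, g (s, u) = g (u, s) := fun s u => by
    simp only [hg]
    rw [← hR.even, neg_sub, neg_sub]
  have hcast : ∀ (i : ℕ) (s : ℝ), 0 ≤ s → ((i : ℝ) + s).toNNReal = i + s.toNNReal := by
    intro i s hs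
    rw [Real.toNNReal_add (Nat.cast_nonneg i) hs, Real.toNNReal_natCast]
  have h01 : ∀ {s : ℝ}, s ∈ uIcc (0 : ℝ) 1 → 0 ≤ s ∧ s ≤ 1 := fun h => by
    rwa [uIcc_of_le zero_le_one] at h
  have hsymm : ∀ i j, A i j = A j i := fun i j => by
    simp only [hA]
    simp only [intervalIntegral.integral_of_le zero_le_one]
    rw [integral_integral_swap]
    · simp_rw [hgsymm]
    · rw [Measure.prod_restrict]
      refine IntegrableOn.mono_set (t := Icc (0 : ℝ) 1 ×ˢ Icc (0 : ℝ) 1) ?_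
        (prod_mono Ioc_subset_Icc_self Ioc_subset_Icc_self)
      exact (Continuous.continuousOn (by fun_prop)).integrableOn_compact
        (isCompact_Icc.prod isCompact_Icc)
  have hzero : ∀ i j, j + 2 ≤ i → A i j = 0 := fun i j hij => by
    have hij' : (j : ℝ) + 2 ≤ i := by exact_mod_cast hij
    refine (intervalIntegral.integral_congr fun s hs => ?_).trans
      (intervalIntegral.integral_zero (a := 0) (b := 1))
    refine (intervalIntegral.integral_congr fun u hu => ?_).trans
      (intervalIntegral.integral_zero (a := 0) (b := 1))
    -- The lag is at least `i - j - 1 ≥ 1`, with equality possible at the corner `s = 0`, `u = 1`.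
    exact hR.eq_zero _ _ (le_abs.2 (.inl (by linarith [(h01 hs).1, (h01 hu).2])))
  have hdiag : ∀ i, A i i = selfInteraction R 1 (shiftPath w i) := fun i => by
    rw [selfInteraction, setIntegral_prod_Icc_eq_intervalIntegral
      (hR.continuous_pair (hw.shiftPath _)) zero_le_one zero_le_one]
    refine intervalIntegral.integral_congr fun s hs => intervalIntegral.integral_congr
      fun u hu => ?_
    simp only [hg, shiftPath, hcast _ _ (h01 hs).1, hcast _ _ (h01 hu).1]
    congr 1 <;> abel
  have hadj : ∀ i, A (i + 1) i =
      neighbourInteraction R (shiftPath w i) (shiftPath w (i + 1)) := fun i => by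
    rw [neighbourInteraction, setIntegral_prod_Icc_eq_intervalIntegral
      (hR.continuous_neighbour (hw.shiftPath _) (hw.shiftPath _)) zero_le_one zero_le_one]
    refine intervalIntegral.integral_congr fun s hs => intervalIntegral.integral_congr
      fun u hu => ?_
    have hcast' : (((i + 1 : ℕ) : ℝ) + s).toNNReal = i + 1 + s.toNNReal := by
      rw [hcast _ _ (h01 hs).1, Nat.cast_add, Nat.cast_one]
    simp only [hg, shiftPath, hcast', hcast _ _ (h01 hu).1]
    congr 1
    · push_cast
      ring
    · abel
  rw [selfInteraction, setIntegral_prod_Icc_eq_intervalIntegral hgc N.cast_nonneg N.cast_nonneg,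
    intervalIntegral_intervalIntegral_nat_eq_sum hgc, sum_range_sum_range_tridiagonal hsymm hzero]
  simp_rw [hdiag, hadj]

/-! ### Measurability of the interactions through countable samples of paths. -/

/-- The type of the values of a path, by coordinate, at the times `m / (n + 1)`. -/
abbrev PathSample : Type := Fin 2 → ℕ × ℕ → ℝ

/-- The restriction of a path to the countably many times `m / (n + 1)`. -/
noncomputable def samplePath (w : ℝ≥0 → Plane) : PathSample := fun i p => w (p.2 / (p.1 + 1)) i

/-- The path recovered from its sample, as a pointwise limit of step functions. -/
noncomputable def reconstruct (x : PathSample) (s : ℝ≥0) : Plane :=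
  WithLp.toLp 2 fun i => limUnder atTop fun n : ℕ => x i (n, ⌊((n : ℝ≥0) + 1) * s⌋₊)

theorem tendsto_floor_succ_mul_div (s : ℝ≥0) :
    Tendsto (fun n : ℕ => ((⌊((n : ℝ≥0) + 1) * s⌋₊ : ℕ) : ℝ≥0) / ((n : ℝ≥0) + 1)) atTop (𝓝 s) := by
  have h := (tendsto_nat_floor_mul_div_atTop (R := ℝ) s.coe_nonneg).comp
    (tendsto_atTop_add_const_right atTop 1 (tendsto_natCast_atTop_atTop (R := ℝ)))
  rw [← NNReal.tendsto_coe]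
  refine h.congr fun n => ?_
  have : (((n : ℝ≥0) + 1) * s : ℝ≥0) = (s : ℝ) * ((n : ℝ) + 1) := by push_cast; ring
  simp only [Function.comp_apply, NNReal.coe_div, NNReal.coe_natCast, NNReal.coe_add,
    NNReal.coe_one, ← this]
  congr 2

theorem reconstruct_samplePath {w : ℝ≥0 → Plane} (hw : Continuous w) :
    reconstruct (samplePath w) = w := by
  ext s i
  refine Tendsto.limUnder_eq ?_
  have hi : Continuous fun t => w t i := by fun_prop
  exact (hi.tendsto s).comp (tendsto_floor_succ_mul_div s)

/-- Joint measurability in sample and time makes the interaction integrals measurable in the sample.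
It holds for all samples, since `limUnder` of measurable functions is measurable even where the
sequence diverges. -/
theorem measurable_reconstruct : Measurable fun q : PathSample × ℝ≥0 => reconstruct q.1 q.2 := by
  refine (PiLp.continuous_toLp 2 _).measurable.comp (measurable_pi_lambda _ fun i => ?_)
  refine (StronglyMeasurable.limUnder fun n => Measurable.stronglyMeasurable ?_).measurable
  have h : Measurable fun q : PathSample × ℕ => q.1 i (n, q.2) :=
    measurable_from_prod_countable_left fun k =>
      (measurable_pi_apply (n, k)).comp (measurable_pi_apply i)
  exact h.comp (measurable_fst.prodMk
    (Nat.measurable_floor.comp (measurable_const.mul measurable_snd)))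

theorem Measurable.reconstruct {α : Type*} [MeasurableSpace α] {x : α → PathSample} {s : α → ℝ≥0}
    (hx : Measurable x) (hs : Measurable s) : Measurable fun a => reconstruct (x a) (s a) :=
  measurable_reconstruct.comp (hx.prodMk hs)

theorem measurable_selfInteraction_reconstruct {R : ℝ → Plane → ℝ} {K : ℝ}
    (hR : IsInteractionKernel R K) (T : ℝ) :
    Measurable fun x : PathSample => selfInteraction R T (reconstruct x) := by
  refine (StronglyMeasurable.integral_prod_right (ν := volume.restrict (Icc 0 T ×ˢ Icc 0 T))
    (f := fun (x : PathSample) (p : ℝ × ℝ) => R (p.1 - p.2)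
      (reconstruct x p.1.toNNReal - reconstruct x p.2.toNNReal)) ?_).measurable
  refine Measurable.stronglyMeasurable (hR.cont.measurable.comp (Measurable.prodMk ?_ ?_))
  · fun_prop
  · exact (Measurable.reconstruct (by fun_prop) (by fun_prop)).sub
      (Measurable.reconstruct (by fun_prop) (by fun_prop))

theorem measurable_neighbourInteraction_reconstruct {R : ℝ → Plane → ℝ} {K : ℝ}
    (hR : IsInteractionKernel R K) :
    Measurable fun q : PathSample × PathSample =>
      neighbourInteraction R (reconstruct q.1) (reconstruct q.2) := by
  refine (StronglyMeasurable.integral_prod_right (ν := volume.restrict (Icc 0 1 ×ˢ Icc 0 1))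
    (f := fun (q : PathSample × PathSample) (p : ℝ × ℝ) => R (1 + p.1 - p.2)
      (reconstruct q.1 1 + reconstruct q.2 p.1.toNNReal -
        reconstruct q.1 p.2.toNNReal)) ?_).measurable
  refine Measurable.stronglyMeasurable (hR.cont.measurable.comp (Measurable.prodMk ?_ ?_))
  · fun_prop
  · exact ((Measurable.reconstruct (by fun_prop) measurable_const).add
      (Measurable.reconstruct (by fun_prop) (by fun_prop))).sub
      (Measurable.reconstruct (by fun_prop) (by fun_prop))

/-! ### The unit segments of Brownian motion are i.i.d. -/

/-- The increment of `w` over the unit time interval after `k`, stopped at time `1`. -/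
def unitSegment (w : ℝ≥0 → Plane) (k : ℝ≥0) (t : ℝ≥0) : Plane := shiftPath w k (min t 1)

theorem Continuous.unitSegment {w : ℝ≥0 → Plane} (hw : Continuous w) (k : ℝ≥0) :
    Continuous (unitSegment w k) :=
  (hw.shiftPath k).comp (continuous_id.min continuous_const)

theorem unitSegment_of_le_one {w : ℝ≥0 → Plane} {k t : ℝ≥0} (ht : t ≤ 1) :
    unitSegment w k t = shiftPath w k t := by
  rw [unitSegment, min_eq_left ht]

namespace IsPlanarBrownian

variable {Ω : Type*} [MeasurableSpace Ω] {P : Measure Ω} {B : ℝ≥0 → Ω → Plane}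

theorem ae_continuous (hB : IsPlanarBrownian B P) : ∀ᵐ η ∂P, Continuous fun t => B t η := by
  filter_upwards [(hB.coord 0).cont, (hB.coord 1).cont] with η h0 h1
  have : Continuous fun t => (B t η).ofLp :=
    continuous_pi fun i => by fin_cases i <;> assumption
  exact (PiLp.continuous_toLp 2 _).comp this

theorem ae_eval_zero (hB : IsPlanarBrownian B P) : ∀ᵐ η ∂P, B 0 η = 0 := by
  filter_upwards [(hB.coord 0).eval_zero_ae_eq_zero, (hB.coord 1).eval_zero_ae_eq_zero]
    with η h0 h1
  ext i
  fin_cases i <;> assumption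

theorem aemeasurable_coord (hB : IsPlanarBrownian B P) (i : Fin 2) (t : ℝ≥0) :
    AEMeasurable (fun η => B t η i) P :=
  (hB.coord i).aemeasurable t

theorem aemeasurable_samplePath (hB : IsPlanarBrownian B P) :
    AEMeasurable (fun η => samplePath fun t => B t η) P :=
  aemeasurable_pi_lambda _ fun i => aemeasurable_pi_lambda _ fun _ => hB.aemeasurable_coord i _

theorem aemeasurable_unitSegment (hB : IsPlanarBrownian B P) (k : ℝ≥0) :
    AEMeasurable (fun η => samplePath (unitSegment (fun t => B t η) k)) P :=
  aemeasurable_pi_lambda _ fun i => aemeasurable_pi_lambda _ fun _ =>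
    (hB.aemeasurable_coord i _).sub (hB.aemeasurable_coord i _)

theorem isGaussianProcess_coord (hB : IsPlanarBrownian B P) (i : Fin 2) :
    IsGaussianProcess (fun t η => B t η i) P :=
  IsPreBrownianReal.isGaussianProcess (hB.coord i).toIsPreBrownianReal

/-- The coordinates of a planar Brownian motion are jointly Gaussian. -/
theorem isGaussianProcess (hB : IsPlanarBrownian B P) :
    IsGaussianProcess (fun (q : Fin 2 × ℝ≥0) η => B q.2 η q.1) P where
  hasGaussianLaw I := by
    classical
    set J := I.image Prod.snd
    have h : HasGaussianLaw (fun η (i : Fin 2) (t : J) => B t η i) P := by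
      refine iIndepFun.hasGaussianLaw
        (fun i => (hB.isGaussianProcess_coord i).hasGaussianLaw J) ?_
      exact hB.indep.comp (fun _ => J.restrict) fun _ => Finset.measurable_restrict J
    let L : (Fin 2 → J → ℝ) →L[ℝ] (I → ℝ) :=
      { toFun x q := x q.1.1 ⟨q.1.2, Finset.mem_image_of_mem _ q.2⟩
        map_add' x y := by ext; simp
        map_smul' c x := by ext; simp }
    exact h.map L

theorem covariance_coord_of_ne [IsProbabilityMeasure P] (hB : IsPlanarBrownian B P)
    {i j : Fin 2} (hij : i ≠ j) (s t : ℝ≥0) :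
    cov[fun η => B s η i, fun η => B t η j; P] = 0 := by
  have h : IndepFun (fun η => B s η i) (fun η => B t η j) P :=
    (hB.indep.indepFun hij).comp (measurable_pi_apply s) (measurable_pi_apply t)
  exact h.covariance_eq_zero ((hB.isGaussianProcess_coord i).hasGaussianLaw_eval s).memLp_two
    ((hB.isGaussianProcess_coord j).hasGaussianLaw_eval t).memLp_two

/-- All sampled increments are jointly Gaussian, so it suffices that different segments are
uncorrelated. Stopping at time `1` confines segment `k` to `[k, k + 1]`; for `k ≠ l` the four
covariances `min s t` then cancel. -/
theorem iIndepFun_unitSegment [IsProbabilityMeasure P] (hB : IsPlanarBrownian B P) :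
    iIndepFun (fun (k : ℕ) η => samplePath (unitSegment (fun t => B t η) k)) P := by
  classical
  set τ : Fin 2 × (ℕ × ℕ) → ℝ≥0 := fun q => min (q.2.2 / (q.2.1 + 1)) 1
  set X : ℕ → Fin 2 × (ℕ × ℕ) → Ω → ℝ := fun k q η => B (k + τ q) η q.1 - B k η q.1
  have mB : ∀ i t, MemLp (fun η => B t η i) 2 P := fun i t =>
    ((hB.isGaussianProcess_coord i).hasGaussianLaw_eval t).memLp_two
  have hX : iIndepFun (fun k η q => X k q η) P := by
    refine IsGaussianProcess.iIndepFun_of_covariance_eq_zero ?_ (fun k q => ?_) ?_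
    · refine hB.isGaussianProcess.of_isGaussianProcess fun p => ?_
      exact ⟨{(p.2.1, p.1 + τ p.2), (p.2.1, (p.1 : ℝ≥0))},
        { toFun x := x ⟨(p.2.1, p.1 + τ p.2), by simp⟩ - x ⟨(p.2.1, (p.1 : ℝ≥0)), by simp⟩
          map_add' x y := by simp; abel
          map_smul' c x := by simp; ring }, by simp [X]⟩
    · exact (hB.aemeasurable_coord _ _).sub (hB.aemeasurable_coord _ _)
    · intro k l hkl p q
      simp only [X]
      rw [covariance_fun_sub_fun_sub (mB _ _) (mB _ _) (mB _ _) (mB _ _)]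
      rcases eq_or_ne p.1 q.1 with h | h
      · simp_rw [h, (hB.coord q.1).covariance_fun_eval]
        have hp : τ p ≤ 1 := min_le_right _ _
        have hq : τ q ≤ 1 := min_le_right _ _
        rcases lt_or_gt_of_ne hkl with hlt | hlt
        · have : (k : ℝ≥0) + 1 ≤ l := by exact_mod_cast hlt
          have h1 : (k : ℝ≥0) + τ p ≤ l := (add_le_add_right hp _).trans this
          have h2 : (k : ℝ≥0) ≤ l := le_self_add.trans this
          rw [min_eq_left (h1.trans le_self_add), min_eq_left h1,
            min_eq_left (h2.trans le_self_add), min_eq_left h2]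
          ring
        · have : (l : ℝ≥0) + 1 ≤ k := by exact_mod_cast hlt
          have h1 : (l : ℝ≥0) + τ q ≤ k := (add_le_add_right hq _).trans this
          have h2 : (l : ℝ≥0) ≤ k := le_self_add.trans this
          rw [min_eq_right (h1.trans le_self_add), min_eq_right h1,
            min_eq_right (h2.trans le_self_add), min_eq_right h2]
          ring
      · simp [hB.covariance_coord_of_ne h]
  exact hX.comp (fun _ x i p => x (i, p)) fun _ => by fun_prop

/-- By independence of the coordinates one coordinate suffices. There the increments after time `k`
form again a Brownian motion, and finite-dimensional laws determine the law of the sample. -/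
theorem identDistrib_unitSegment [IsProbabilityMeasure P] (hB : IsPlanarBrownian B P) (k : ℝ≥0) :
    IdentDistrib (fun η => samplePath (unitSegment (fun t => B t η) k))
      (fun η => samplePath (unitSegment (fun t => B t η) 0)) P P := by
  have hmeas : ∀ (k : ℝ≥0) (i : Fin 2),
      Measurable fun (w : ℝ≥0 → ℝ) (p : ℕ × ℕ) => w (k + min ((p.2 : ℝ≥0) / (p.1 + 1)) 1) - w k :=
    fun k i => by fun_prop
  refine IdentDistrib.pi (fun i => ?_) (hB.indep.comp _ (hmeas k)) (hB.indep.comp _ (hmeas 0))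
  have hae : ∀ k, AEMeasurable
      (fun η (p : ℕ × ℕ) => B (k + min ((p.2 : ℝ≥0) / (p.1 + 1)) 1) η i - B k η i) P := fun k =>
    aemeasurable_pi_lambda _ fun _ => (hB.aemeasurable_coord i _).sub (hB.aemeasurable_coord i _)
  refine (identDistrib_iff_forall_finset_identDistrib (hae k) (hae 0)).2 fun I => ?_
  classical
  set J := I.image fun p : ℕ × ℕ => min ((p.2 : ℝ≥0) / (p.1 + 1)) 1
  have hlaw : ∀ k, HasLaw (fun η => J.restrict fun t => B (k + t) η i - B k η i)
      (BrownianReal.projectiveFamily J) P := fun k =>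
    ((hB.coord i).toIsPreBrownianReal.shift k).hasLaw J
  exact (IdentDistrib.mk (hlaw k).aemeasurable (hlaw 0).aemeasurable
    ((hlaw k).map_eq.trans (hlaw 0).map_eq.symm)).comp (u := fun x (p : I) =>
    x ⟨_, Finset.mem_image_of_mem _ p.2⟩) (by fun_prop)

end IsPlanarBrownian

/-! ### Exponential moments of sums over consecutive pairs of an i.i.d. sequence. -/

/-- From `1 - x ≤ exp (-x)` follows `exp x - 1 ≤ x exp x`; multiplying by `x` bounds the
second-order remainder. -/
theorem Real.exp_le_one_add_add_sq_mul_exp {x : ℝ} (hx : 0 ≤ x) :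
    Real.exp x ≤ 1 + x + x ^ 2 * Real.exp x := by
  have h1 : Real.exp x - 1 ≤ x * Real.exp x := by
    have h := mul_le_mul_of_nonneg_right (Real.add_one_le_exp (-x)) (Real.exp_pos x).le
    rw [← Real.exp_add, neg_add_cancel, Real.exp_zero] at h
    linarith
  nlinarith [mul_le_mul_of_nonneg_left h1 hx]

theorem Finset.sum_range_two_mul (a : ℕ → ℝ) (M : ℕ) :
    ∑ k ∈ Finset.range (2 * M), a k =
      ∑ j ∈ Finset.range M, a (2 * j) + ∑ j ∈ Finset.range M, a (2 * j + 1) := by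
  induction M with
  | zero => simp
  | succ M ih =>
    rw [show 2 * (M + 1) = 2 * M + 1 + 1 by ring, Finset.sum_range_succ, Finset.sum_range_succ, ih,
      Finset.sum_range_succ, Finset.sum_range_succ]
    ring

section IndependentSequence

variable {Ω E : Type*} [MeasurableSpace Ω] [MeasurableSpace E] {P : Measure Ω}
  [IsProbabilityMeasure P] {S : ℕ → Ω → E}

theorem identDistrib_consecutive_pair (hind : iIndepFun S P)
    (hid : ∀ k, IdentDistrib (S k) (S 0) P P) (k : ℕ) :
    IdentDistrib (fun η => (S k η, S (k + 1) η)) id P ((P.map (S 0)).prod (P.map (S 0))) where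
  aemeasurable_fst := (hid k).aemeasurable_fst.prodMk (hid (k + 1)).aemeasurable_fst
  aemeasurable_snd := aemeasurable_id
  map_eq := by
    have h := (indepFun_iff_map_prod_eq_prod_map_map (hid k).aemeasurable_fst
      (hid (k + 1)).aemeasurable_fst).1 (hind.indepFun (Nat.succ_ne_self k).symm)
    rw [Measure.map_id, h, (hid k).map_eq, (hid (k + 1)).map_eq]

theorem integral_consecutive_pair (hind : iIndepFun S P)
    (hid : ∀ k, IdentDistrib (S k) (S 0) P P) {u : E × E → ℝ} (hu : Measurable u) (k : ℕ) :
    ∫ η, u (S k η, S (k + 1) η) ∂P = ∫ q, u q ∂(P.map (S 0)).prod (P.map (S 0)) :=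
  ((identDistrib_consecutive_pair hind hid k).comp hu).integral_eq

/-- With stride `2` the pairs use disjoint indices, hence are independent. The offset `b` selects
the parity. -/
theorem integral_prod_consecutive_pairs (hind : iIndepFun S P)
    (hid : ∀ k, IdentDistrib (S k) (S 0) P P) {u : E × E → ℝ} (hu : Measurable u) (b M : ℕ) :
    ∫ η, ∏ j ∈ Finset.range M, u (S (2 * j + b) η, S (2 * j + b + 1) η) ∂P =
      (∫ q, u q ∂(P.map (S 0)).prod (P.map (S 0))) ^ M := by
  induction M with
  | zero => simp
  | succ M ih =>
    have hS : ∀ k, AEMeasurable (S k) P := fun k => (hid k).aemeasurable_fst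
    have hpair : ∀ j, AEMeasurable (fun η => u (S (2 * j + b) η, S (2 * j + b + 1) η)) P :=
      fun j => hu.comp_aemeasurable ((hS _).prodMk (hS _))
    set A := Finset.range (2 * M + b)
    set T : Finset ℕ := {2 * M + b, 2 * M + b + 1}
    have hdisj : Disjoint A T := by
      refine Finset.disjoint_left.2 fun k hk hk' => ?_
      simp only [A, T, Finset.mem_range, Finset.mem_insert, Finset.mem_singleton] at hk hk'
      omega
    have hA : ∀ j ∈ Finset.range M, 2 * j + b ∈ A ∧ 2 * j + b + 1 ∈ A := fun j hj => by
      simp only [A, Finset.mem_range] at hj ⊢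
      omega
    have hI : IndepFun
        (fun η => ∏ j ∈ Finset.range M, u (S (2 * j + b) η, S (2 * j + b + 1) η))
        (fun η => u (S (2 * M + b) η, S (2 * M + b + 1) η)) P := by
      have := (hind.indepFun_finset₀ A T hdisj hS).comp
        (φ := fun x : A → E => ∏ j ∈ (Finset.range M).attach,
          u (x ⟨_, (hA j j.2).1⟩, x ⟨_, (hA j j.2).2⟩))
        (ψ := fun x : T → E => u (x ⟨2 * M + b, by simp [T]⟩, x ⟨2 * M + b + 1, by simp [T]⟩))
        (Finset.measurable_fun_prod _ fun j _ => hu.comp (by fun_prop))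
        (hu.comp (by fun_prop))
      refine this.congr (.of_forall fun η => ?_) .rfl
      exact Finset.prod_attach (Finset.range M)
        fun j => u (S (2 * j + b) η, S (2 * j + b + 1) η)
    simp_rw [Finset.prod_range_succ]
    rw [hI.integral_fun_mul_eq_mul_integral
      (Finset.aemeasurable_fun_prod _ fun j _ => hpair j).aestronglyMeasurable
      (hpair M).aestronglyMeasurable, ih, integral_consecutive_pair hind hid hu, pow_succ]

variable {h : E × E → ℝ} {H c : ℝ}

/-- Neighbouring pairs share a segment and are dependent. Splitting the sum by parity and using `2xy
≤ x² + y²` leaves two products over independent pairs with coupling `2c`; both have the same mean,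
so their average is that mean. -/
theorem integral_exp_sum_consecutive_pairs_le (hind : iIndepFun S P)
    (hid : ∀ k, IdentDistrib (S k) (S 0) P P) (hh : Measurable h)
    (hH : ∀ q, |h q| ≤ H) (c : ℝ) (M : ℕ) :
    ∫ η, Real.exp (c * ∑ k ∈ Finset.range (2 * M), h (S k η, S (k + 1) η)) ∂P ≤
      (∫ q, Real.exp (2 * c * h q) ∂(P.map (S 0)).prod (P.map (S 0))) ^ M := by
  have hpair : ∀ k, AEMeasurable (fun η => h (S k η, S (k + 1) η)) P := fun k =>
    hh.comp_aemeasurable ((hid k).aemeasurable_fst.prodMk (hid (k + 1)).aemeasurable_fst)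
  have hu : Measurable fun q => Real.exp (2 * c * h q) := by fun_prop
  set U : ℕ → Ω → ℝ := fun b η =>
    ∏ j ∈ Finset.range M, Real.exp (2 * c * h (S (2 * j + b) η, S (2 * j + b + 1) η)) with hUdef
  have hUm : ∀ b, AEMeasurable (U b) P := fun b =>
    Finset.aemeasurable_fun_prod _ fun j _ => ((hpair _).const_mul _).exp
  have hUi : ∀ b, Integrable (U b) P := fun b => by
    refine Integrable.of_bound (hUm b).aestronglyMeasurable
      (∏ j ∈ Finset.range M, Real.exp (|2 * c| * H)) (.of_forall fun η => ?_)
    rw [Real.norm_of_nonneg (Finset.prod_nonneg fun _ _ => (Real.exp_pos _).le)]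
    refine Finset.prod_le_prod (fun _ _ => (Real.exp_pos _).le) fun j _ => ?_
    refine Real.exp_le_exp.2 ((le_abs_self _).trans ?_)
    rw [abs_mul]
    exact mul_le_mul_of_nonneg_left (hH _) (abs_nonneg _)
  have hpt : ∀ η, Real.exp (c * ∑ k ∈ Finset.range (2 * M), h (S k η, S (k + 1) η)) ≤
      (U 0 η + U 1 η) / 2 := fun η => by
    have hUexp : ∀ b, U b η = Real.exp (c * ∑ j ∈ Finset.range M,
        h (S (2 * j + b) η, S (2 * j + b + 1) η)) ^ 2 := fun b => by
      simp only [hUdef]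
      rw [← Real.exp_sum, ← Finset.mul_sum, ← Real.exp_nat_mul]
      rw [Nat.cast_ofNat, mul_assoc]
    rw [hUexp, hUexp, Finset.sum_range_two_mul, mul_add, Real.exp_add]
    have := two_mul_le_add_sq
      (Real.exp (c * ∑ j ∈ Finset.range M, h (S (2 * j) η, S (2 * j + 1) η)))
      (Real.exp (c * ∑ j ∈ Finset.range M, h (S (2 * j + 1) η, S (2 * j + 1 + 1) η)))
    simp only [Nat.add_zero]
    linarith
  calc _ ≤ ∫ η, (U 0 η + U 1 η) / 2 ∂P := integral_mono_of_nonneg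
        (.of_forall fun _ => (Real.exp_pos _).le) (((hUi 0).add (hUi 1)).div_const 2)
        (.of_forall hpt)
    _ = _ := by
      rw [integral_div, integral_add (hUi 0) (hUi 1),
        integral_prod_consecutive_pairs hind hid hu, integral_prod_consecutive_pairs hind hid hu]
      ring

theorem integral_exp_le_of_bounded {Q : Measure E} [IsProbabilityMeasure Q] {f : E → ℝ}
    (hf : Measurable f) (h0 : ∀ q, 0 ≤ f q) (hH : ∀ q, f q ≤ H) :
    ∫ q, Real.exp (f q) ∂Q ≤ 1 + ∫ q, f q ∂Q + H ^ 2 * Real.exp H := by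
  have hfi : Integrable f Q := .of_bound hf.aestronglyMeasurable H
    (.of_forall fun q => by rw [Real.norm_of_nonneg (h0 q)]; exact hH q)
  have hpt : ∀ q, Real.exp (f q) ≤ 1 + f q + H ^ 2 * Real.exp H := fun q => by
    have h1 := Real.exp_le_one_add_add_sq_mul_exp (h0 q)
    have h2 : f q ^ 2 * Real.exp (f q) ≤ H ^ 2 * Real.exp H :=
      mul_le_mul (pow_le_pow_left₀ (h0 q) (hH q) 2) (Real.exp_le_exp.2 (hH q))
        (Real.exp_pos _).le (sq_nonneg _)
    linarith
  calc _ ≤ ∫ q, (1 + f q + H ^ 2 * Real.exp H) ∂Q := integral_mono_of_nonneg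
        (.of_forall fun _ => (Real.exp_pos _).le)
        (((integrable_const _).add hfi).add (integrable_const _)) (.of_forall hpt)
    _ = _ := by
      rw [integral_add (f := fun q => 1 + f q) ((integrable_const _).add hfi)
        (integrable_const _), integral_add (integrable_const _) hfi]
      simp

/-- The logarithmic moment generating function of a sum of bounded functions of consecutive pairs
of an i.i.d. sequence is linear up to a quadratic error. -/
theorem log_integral_exp_sum_consecutive_pairs_le (hind : iIndepFun S P)
    (hid : ∀ k, IdentDistrib (S k) (S 0) P P) (hh : Measurable h) (h0 : ∀ q, 0 ≤ h q)
    (hH : ∀ q, h q ≤ H) (hc : 0 ≤ c) (M : ℕ) :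
    Real.log (∫ η, Real.exp (c * ∑ k ∈ Finset.range (2 * M), h (S k η, S (k + 1) η)) ∂P) ≤
      M * (2 * c * ∫ q, h q ∂(P.map (S 0)).prod (P.map (S 0)) +
        (2 * c * H) ^ 2 * Real.exp (2 * c * H)) := by
  have : IsProbabilityMeasure (P.map (S 0)) :=
    Measure.isProbabilityMeasure_map (hid 0).aemeasurable_fst
  set Q := (P.map (S 0)).prod (P.map (S 0))
  have hle := integral_exp_sum_consecutive_pairs_le hind hid hh
    (fun q => (abs_of_nonneg (h0 q)).trans_le (hH q)) c M
  have hθ := integral_exp_le_of_bounded (Q := Q) (hh.const_mul (2 * c))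
    (fun q => mul_nonneg (by positivity) (h0 q))
    (fun q => mul_le_mul_of_nonneg_left (hH q) (by positivity : 0 ≤ 2 * c))
  rw [integral_const_mul] at hθ
  -- If the integral is `0`, then `Real.log 0 = 0` lies below the nonnegative bound; this spares a
  -- proof that the integral is positive.
  rcases (integral_nonneg fun η => (Real.exp_pos _).le :
    0 ≤ ∫ η, Real.exp (c * ∑ k ∈ Finset.range (2 * M), h (S k η, S (k + 1) η)) ∂P).eq_or_lt
    with hz | hpos
  · rw [← hz, Real.log_zero]
    have : 0 ≤ ∫ q, h q ∂Q := integral_nonneg h0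
    positivity
  refine (Real.log_le_log hpos hle).trans ?_
  rw [Real.log_pow]
  refine mul_le_mul_of_nonneg_left ?_ M.cast_nonneg
  have hm : 0 ≤ ∫ q, h q ∂Q := integral_nonneg h0
  rcases (integral_nonneg fun q => (Real.exp_pos _).le :
    0 ≤ ∫ q, Real.exp (2 * c * h q) ∂Q).eq_or_lt with hz | hpos
  · rw [← hz, Real.log_zero]
    positivity
  · linarith [Real.log_le_sub_one_of_pos hpos]

end IndependentSequence

/-- Jensen's inequality for the logarithmic moment generating function. -/
theorem integral_le_log_integral_exp {Ω : Type*} [MeasurableSpace Ω] {P : Measure Ω}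
    [IsProbabilityMeasure P] {Z : Ω → ℝ} (hZ : Integrable Z P)
    (hexp : Integrable (fun η => Real.exp (Z η)) P) :
    ∫ η, Z η ∂P ≤ Real.log (∫ η, Real.exp (Z η) ∂P) := by
  have h := convexOn_exp.map_integral_le Real.continuous_exp.continuousOn isClosed_univ
    (.of_forall fun _ => mem_univ _) hZ hexp
  rw [Real.le_log_iff_exp_le ((Real.exp_pos _).trans_le h)]
  exact h

/-- The error is shared proportionally: the ratio `e / (A x + D)`, of absolute value at most `1`,
multiplies both `A` and `D`. -/
theorem exists_split_of_abs_le {e A D x : ℝ} (hA : 0 ≤ A) (hD : 0 ≤ D) (hx : 0 < x)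
    (he : |e| ≤ A * x + D) : ∃ o₁ o₂ : ℝ, |o₁| ≤ A ∧ |o₂| ≤ D ∧ e = o₁ * x + o₂ := by
  rcases (by positivity : 0 ≤ A * x + D).eq_or_lt with h | h
  · exact ⟨0, 0, by simpa, by simpa, by simpa [← h] using he⟩
  · have hr : |e / (A * x + D)| ≤ 1 := by rwa [abs_div, abs_of_pos h, div_le_one h]
    refine ⟨e / (A * x + D) * A, e / (A * x + D) * D, ?_, ?_, by field_simp⟩
    · rw [abs_mul, abs_of_nonneg hA]
      exact mul_le_of_le_one_left hA hr
    · rw [abs_mul, abs_of_nonneg hD]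
      exact mul_le_of_le_one_left hD hr

theorem reconstruct_samplePath_unitSegment_of_le_one {w : ℝ≥0 → Plane} (hw : Continuous w)
    (k : ℝ≥0) {t : ℝ≥0} (ht : t ≤ 1) :
    reconstruct (samplePath (unitSegment w k)) t = shiftPath w k t := by
  rw [reconstruct_samplePath (hw.unitSegment k), unitSegment_of_le_one ht]

theorem selfInteraction_reconstruct_unitSegment (R : ℝ → Plane → ℝ) {w : ℝ≥0 → Plane}
    (hw : Continuous w) (k : ℝ≥0) :
    selfInteraction R 1 (reconstruct (samplePath (unitSegment w k))) =
      selfInteraction R 1 (shiftPath w k) :=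
  selfInteraction_one_congr fun t ht s hs => by
    simp only [reconstruct_samplePath_unitSegment_of_le_one hw k, ht, hs]

theorem neighbourInteraction_reconstruct_unitSegment (R : ℝ → Plane → ℝ) {w v : ℝ≥0 → Plane}
    (hw : Continuous w) (hv : Continuous v) (k l : ℝ≥0) :
    neighbourInteraction R (reconstruct (samplePath (unitSegment w k)))
        (reconstruct (samplePath (unitSegment v l))) =
      neighbourInteraction R (shiftPath w k) (shiftPath v l) :=
  neighbourInteraction_congr
    (fun _ ht => reconstruct_samplePath_unitSegment_of_le_one hw k ht)
    (fun _ ht => reconstruct_samplePath_unitSegment_of_le_one hv l ht)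

/-! ### Upper and lower bounds for the free energy. -/

section FreeEnergy

variable {R : ℝ → Plane → ℝ} {K : ℝ}

/-- The interaction energy attributed to a unit segment followed by another one. -/
noncomputable def pairEnergy (R : ℝ → Plane → ℝ) (q : PathSample × PathSample) : ℝ :=
  selfInteraction R 1 (reconstruct q.1) / 2 +
    neighbourInteraction R (reconstruct q.1) (reconstruct q.2)

theorem measurable_pairEnergy (hR : IsInteractionKernel R K) : Measurable (pairEnergy R) :=
  (((measurable_selfInteraction_reconstruct hR 1).comp measurable_fst).div_const 2).add
    (measurable_neighbourInteraction_reconstruct hR)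

theorem pairEnergy_nonneg (hR : IsInteractionKernel R K) (q : PathSample × PathSample) :
    0 ≤ pairEnergy R q :=
  add_nonneg (div_nonneg (selfInteraction_nonneg hR _ _) zero_le_two)
    (neighbourInteraction_nonneg hR _ _)

theorem pairEnergy_le (hR : IsInteractionKernel R K) (q : PathSample × PathSample) :
    pairEnergy R q ≤ 3 / 2 * K := by
  have h1 := selfInteraction_le hR zero_le_one (reconstruct q.1)
  have h2 := neighbourInteraction_le hR (reconstruct q.1) (reconstruct q.2)
  rw [pairEnergy]
  linarith

/-- The right-hand side has one extra nonnegative term, the interaction of the last segment with the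
one after it. Including it makes every summand the same function of a consecutive pair. -/
theorem selfInteraction_two_mul_le (hR : IsInteractionKernel R K) {w : ℝ≥0 → Plane}
    (hw : Continuous w) (M : ℕ) :
    selfInteraction R (2 * M : ℕ) w ≤ 2 * ∑ k ∈ Finset.range (2 * M), pairEnergy R
      (samplePath (unitSegment w k), samplePath (unitSegment w (k + 1 : ℕ))) := by
  rw [selfInteraction_natCast hR hw, Finset.mul_sum, Finset.mul_sum]
  simp only [pairEnergy, selfInteraction_reconstruct_unitSegment R hw,
    neighbourInteraction_reconstruct_unitSegment R hw hw, mul_add,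
    Finset.sum_add_distrib, Nat.cast_add, Nat.cast_one, ← Finset.mul_sum, ← Finset.sum_div]
  have h : ∑ i ∈ Finset.range (2 * M - 1),
        neighbourInteraction R (shiftPath w i) (shiftPath w (i + 1)) ≤
      ∑ i ∈ Finset.range (2 * M),
        neighbourInteraction R (shiftPath w i) (shiftPath w (i + 1)) :=
    Finset.sum_le_sum_of_subset_of_nonneg (Finset.range_subset_range.2 (Nat.sub_le _ _))
      fun _ _ _ => neighbourInteraction_nonneg hR _ _
  linarith

variable {Ω : Type*} [MeasurableSpace Ω] {P : Measure Ω} {B : ℝ≥0 → Ω → Plane}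

theorem aemeasurable_selfInteraction (hR : IsInteractionKernel R K) (hB : IsPlanarBrownian B P)
    (T : ℝ) : AEMeasurable (fun η => selfInteraction R T fun t => B t η) P := by
  refine ((measurable_selfInteraction_reconstruct hR T).comp_aemeasurable
    hB.aemeasurable_samplePath).congr ?_
  filter_upwards [hB.ae_continuous] with η hη
  simp only [Function.comp_apply, reconstruct_samplePath hη]

theorem neighbourMean_nonneg (hR : IsInteractionKernel R K) :
    0 ≤ ∫ η₁, ∫ η₂, neighbourInteraction R (fun t => B t η₁) (fun t => B t η₂) ∂P ∂P :=
  integral_nonneg fun _ => integral_nonneg fun _ => neighbourInteraction_nonneg hR _ _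

theorem leadingConst_eq (β : ℝ) : leadingConst R β B P = β ^ 2 * leadingConst R 1 B P := by
  simp only [leadingConst]
  ring

variable [IsProbabilityMeasure P]

theorem integrable_selfInteraction (hR : IsInteractionKernel R K) (hB : IsPlanarBrownian B P)
    {T : ℝ} (hT : 0 ≤ T) : Integrable (fun η => selfInteraction R T fun t => B t η) P :=
  .of_bound (aemeasurable_selfInteraction hR hB T).aestronglyMeasurable (K * T ^ 2)
    (.of_forall fun η => by
      rw [Real.norm_of_nonneg (selfInteraction_nonneg hR _ _)]
      exact selfInteraction_le hR hT _)

theorem integrable_exp_selfInteraction (hR : IsInteractionKernel R K)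
    (hB : IsPlanarBrownian B P) {T c : ℝ} (hT : 0 ≤ T) (hc : 0 ≤ c) :
    Integrable (fun η => Real.exp (c * selfInteraction R T fun t => B t η)) P :=
  .of_bound ((aemeasurable_selfInteraction hR hB T).const_mul c).exp.aestronglyMeasurable
    (Real.exp (c * (K * T ^ 2))) (.of_forall fun η => by
      rw [Real.norm_of_nonneg (Real.exp_pos _).le]
      exact Real.exp_le_exp.2 (mul_le_mul_of_nonneg_left (selfInteraction_le hR hT _) hc))

theorem integral_selfInteraction_shiftPath (hR : IsInteractionKernel R K)
    (hB : IsPlanarBrownian B P) (k : ℝ≥0) :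
    ∫ η, selfInteraction R 1 (shiftPath (fun t => B t η) k) ∂P =
      ∫ η, selfInteraction R 1 (fun t => B t η) ∂P := by
  have h := ((hB.identDistrib_unitSegment k).comp
    (measurable_selfInteraction_reconstruct hR 1)).integral_eq
  simp only [Function.comp_apply] at h
  refine ((integral_congr_ae ?_).trans h).trans (integral_congr_ae ?_)
  · filter_upwards [hB.ae_continuous] with η hη
    exact (selfInteraction_reconstruct_unitSegment R hη k).symm
  · filter_upwards [hB.ae_continuous] with η hη
    rw [selfInteraction_reconstruct_unitSegment R hη]
    exact selfInteraction_one_congr fun t _ s _ => by simp [shiftPath]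

theorem integrable_reconstruct_neighbour (hR : IsInteractionKernel R K)
    (Q : Measure (PathSample × PathSample)) [IsFiniteMeasure Q] :
    Integrable (fun q => neighbourInteraction R (reconstruct q.1) (reconstruct q.2)) Q :=
  .of_bound (measurable_neighbourInteraction_reconstruct hR).aestronglyMeasurable K
    (.of_forall fun q => by
      rw [Real.norm_of_nonneg (neighbourInteraction_nonneg hR _ _)]
      exact neighbourInteraction_le hR _ _)

/-- Fubini turns the product law into the iterated expectation; as `B 0 = 0` almost surely, segment
`0` is the path itself up to time `1`. -/
theorem integral_neighbourInteraction_reconstruct (hR : IsInteractionKernel R K)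
    (hB : IsPlanarBrownian B P) :
    ∫ q, neighbourInteraction R (reconstruct q.1) (reconstruct q.2)
        ∂(P.map fun η => samplePath (unitSegment (fun t => B t η) (0 : ℕ))).prod
          (P.map fun η => samplePath (unitSegment (fun t => B t η) (0 : ℕ))) =
      ∫ η₁, ∫ η₂, neighbourInteraction R (fun t => B t η₁) (fun t => B t η₂) ∂P ∂P := by
  have hm := hB.aemeasurable_unitSegment (0 : ℕ)
  have := Measure.isProbabilityMeasure_map hm
  have hmeas := measurable_neighbourInteraction_reconstruct hR
  rw [integral_prod _ (integrable_reconstruct_neighbour hR _), integral_map hm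
    hmeas.stronglyMeasurable.integral_prod_right'.aestronglyMeasurable]
  refine integral_congr_ae ?_
  filter_upwards [hB.ae_continuous, hB.ae_eval_zero] with η₁ h1 h1'
  refine (integral_map hm (hmeas.comp measurable_prodMk_left).aestronglyMeasurable).trans ?_
  refine integral_congr_ae ?_
  filter_upwards [hB.ae_continuous, hB.ae_eval_zero] with η₂ h2 h2'
  refine (neighbourInteraction_reconstruct_unitSegment R h1 h2 _ _).trans ?_
  exact neighbourInteraction_congr (fun t _ => by simp [shiftPath, h1'])
    fun t _ => by simp [shiftPath, h2']

theorem integral_neighbourInteraction_shiftPath (hR : IsInteractionKernel R K)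
    (hB : IsPlanarBrownian B P) (k : ℕ) :
    ∫ η, neighbourInteraction R (shiftPath (fun t => B t η) k)
        (shiftPath (fun t => B t η) (k + 1)) ∂P =
      ∫ η₁, ∫ η₂, neighbourInteraction R (fun t => B t η₁) (fun t => B t η₂) ∂P ∂P := by
  have h := integral_consecutive_pair hB.iIndepFun_unitSegment
    (fun k => by simpa using hB.identDistrib_unitSegment k)
    (measurable_neighbourInteraction_reconstruct hR) k
  rw [integral_neighbourInteraction_reconstruct hR hB] at h
  rw [← h]
  refine integral_congr_ae ?_
  filter_upwards [hB.ae_continuous] with η hη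
  rw [neighbourInteraction_reconstruct_unitSegment R hη hη]
  simp

theorem integral_pairEnergy (hR : IsInteractionKernel R K) (hB : IsPlanarBrownian B P) :
    ∫ q, pairEnergy R q
        ∂(P.map fun η => samplePath (unitSegment (fun t => B t η) (0 : ℕ))).prod
          (P.map fun η => samplePath (unitSegment (fun t => B t η) (0 : ℕ))) =
      leadingConst R 1 B P := by
  have hm := hB.aemeasurable_unitSegment (0 : ℕ)
  have := Measure.isProbabilityMeasure_map hm
  have hself := measurable_selfInteraction_reconstruct hR 1
  have hint : Integrable (fun q : PathSample × PathSample =>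
      selfInteraction R 1 (reconstruct q.1))
      ((P.map fun η => samplePath (unitSegment (fun t => B t η) (0 : ℕ))).prod
        (P.map fun η => samplePath (unitSegment (fun t => B t η) (0 : ℕ)))) :=
    .of_bound (hself.comp measurable_fst).aestronglyMeasurable K (.of_forall fun q => by
      rw [Real.norm_of_nonneg (selfInteraction_nonneg hR _ _)]
      simpa using selfInteraction_le hR zero_le_one (reconstruct q.1))
  simp only [pairEnergy]
  rw [integral_add (hint.div_const 2) (integrable_reconstruct_neighbour hR _), integral_div,
    integral_neighbourInteraction_reconstruct hR hB,
    integral_fun_fst (fun x => selfInteraction R 1 (reconstruct x)),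
    integral_map hm hself.aestronglyMeasurable, leadingConst]
  have h0 : ∫ η, selfInteraction R 1
      (reconstruct (samplePath (unitSegment (fun t => B t η) (0 : ℕ)))) ∂P =
      ∫ η, selfInteraction R 1 (fun t => B t η) ∂P := by
    rw [← integral_selfInteraction_shiftPath hR hB (0 : ℕ)]
    refine integral_congr_ae ?_
    filter_upwards [hB.ae_continuous] with η hη
    exact selfInteraction_reconstruct_unitSegment R hη _
  rw [h0, probReal_univ]
  simp
  ring

theorem integral_selfInteraction_natCast (hR : IsInteractionKernel R K)
    (hB : IsPlanarBrownian B P) (N : ℕ) :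
    ∫ η, selfInteraction R N (fun t => B t η) ∂P =
      N * ∫ η, selfInteraction R 1 (fun t => B t η) ∂P + 2 * ((N - 1 : ℕ) *
        ∫ η₁, ∫ η₂, neighbourInteraction R (fun t => B t η₁) (fun t => B t η₂) ∂P ∂P) := by
  have hX : ∀ i : ℕ, Integrable
      (fun η => selfInteraction R 1 (shiftPath (fun t => B t η) i)) P := fun i => by
    refine .of_bound (AEMeasurable.aestronglyMeasurable ?_) K (.of_forall fun η => ?_)
    · refine ((measurable_selfInteraction_reconstruct hR 1).comp_aemeasurable
        (hB.aemeasurable_unitSegment i)).congr ?_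
      filter_upwards [hB.ae_continuous] with η hη
      exact selfInteraction_reconstruct_unitSegment R hη _
    · rw [Real.norm_of_nonneg (selfInteraction_nonneg hR _ _)]
      simpa using selfInteraction_le hR zero_le_one _
  have hY : ∀ i : ℕ, Integrable (fun η => neighbourInteraction R
      (shiftPath (fun t => B t η) i) (shiftPath (fun t => B t η) (i + 1))) P := fun i => by
    refine .of_bound (AEMeasurable.aestronglyMeasurable ?_) K (.of_forall fun η => ?_)
    · refine ((measurable_neighbourInteraction_reconstruct hR).comp_aemeasurable
        ((hB.aemeasurable_unitSegment i).prodMk (hB.aemeasurable_unitSegment (i + 1)))).congr ?_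
      filter_upwards [hB.ae_continuous] with η hη
      exact neighbourInteraction_reconstruct_unitSegment R hη hη _ _
    · rw [Real.norm_of_nonneg (neighbourInteraction_nonneg hR _ _)]
      exact neighbourInteraction_le hR _ _
  rw [integral_congr_ae (hB.ae_continuous.mono fun η hη => selfInteraction_natCast hR hη N),
    integral_add (integrable_finsetSum _ fun i _ => hX i)
      ((integrable_finsetSum _ fun i _ => hY i).const_mul 2),
    integral_const_mul, integral_finsetSum _ fun i _ => hX i,
    integral_finsetSum _ fun i _ => hY i]
  simp [integral_selfInteraction_shiftPath hR hB, integral_neighbourInteraction_shiftPath hR hB]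

theorem integral_selfInteraction_one_pos (hR : IsInteractionKernel R K)
    (hB : IsPlanarBrownian B P) : 0 < ∫ η, selfInteraction R 1 (fun t => B t η) ∂P := by
  rw [integral_pos_iff_support_of_nonneg_ae (.of_forall fun _ => selfInteraction_nonneg hR _ _)
    (integrable_selfInteraction hR hB zero_le_one)]
  refine lt_of_lt_of_eq one_pos (Eq.symm ?_)
  rw [← measure_univ (μ := P)]
  refine measure_congr ?_
  filter_upwards [hB.ae_continuous] with η hη
  exact propext ⟨fun _ => trivial, fun _ => (selfInteraction_one_pos hR hη).ne'⟩

theorem neighbourMean_le (hR : IsInteractionKernel R K) (hB : IsPlanarBrownian B P) :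
    ∫ η₁, ∫ η₂, neighbourInteraction R (fun t => B t η₁) (fun t => B t η₂) ∂P ∂P ≤ K := by
  rw [← integral_neighbourInteraction_shiftPath hR hB 0]
  refine (integral_mono_of_nonneg (.of_forall fun _ => neighbourInteraction_nonneg hR _ _)
    (integrable_const K) (.of_forall fun _ => neighbourInteraction_le hR _ _)).trans ?_
  simp

theorem selfMean_le (hR : IsInteractionKernel R K) :
    ∫ η, selfInteraction R 1 (fun t => B t η) ∂P ≤ K := by
  refine (integral_mono_of_nonneg (.of_forall fun _ => selfInteraction_nonneg hR _ _)
    (integrable_const K) (.of_forall fun η => ?_)).trans ?_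
  · simpa using selfInteraction_le hR zero_le_one fun t => B t η
  · simp

theorem leadingConst_pos (hR : IsInteractionKernel R K) (hB : IsPlanarBrownian B P) {β : ℝ}
    (hβ : β ≠ 0) : 0 < leadingConst R β B P := by
  have h1 := integral_selfInteraction_one_pos hR hB
  have h2 := neighbourMean_nonneg (P := P) (B := B) hR
  rw [leadingConst]
  positivity

/-- The time interval is enlarged to `2M` unit segments with `M = ⌈T/2⌉ ≤ T/2 + 1`. The exponent `3
c K` is the doubled coupling `2c` times the bound `3K/2` on the pair energy. -/
theorem logMoment_le (hR : IsInteractionKernel R K) (hB : IsPlanarBrownian B P) {T c : ℝ}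
    (hT : 0 ≤ T) (hc : 0 ≤ c) :
    Real.log (∫ η, Real.exp (c / 2 * selfInteraction R T fun t => B t η) ∂P) ≤
      (T / 2 + 1) * (2 * c * leadingConst R 1 B P +
        (3 * c * K) ^ 2 * Real.exp (3 * c * K)) := by
  set M := ⌈T / 2⌉₊ with hM
  have hTM : T ≤ (2 * M : ℕ) := by
    push_cast
    linarith [Nat.le_ceil (T / 2)]
  have hMT : (M : ℝ) ≤ T / 2 + 1 := (Nat.ceil_lt_add_one (by positivity)).le
  have hiid := log_integral_exp_sum_consecutive_pairs_le hB.iIndepFun_unitSegment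
    (fun k => by simpa using hB.identDistrib_unitSegment k) (measurable_pairEnergy hR)
    (pairEnergy_nonneg hR) (pairEnergy_le hR) hc M
  rw [integral_pairEnergy hR hB, show 2 * c * (3 / 2 * K) = 3 * c * K by ring] at hiid
  have hpair : ∀ k : ℕ, AEMeasurable (fun η => pairEnergy R
      (samplePath (unitSegment (fun t => B t η) k),
        samplePath (unitSegment (fun t => B t η) (k + 1 : ℕ)))) P := fun k =>
    (measurable_pairEnergy hR).comp_aemeasurable
      ((hB.aemeasurable_unitSegment _).prodMk (hB.aemeasurable_unitSegment _))
  have hint : Integrable (fun η => Real.exp (c * ∑ k ∈ Finset.range (2 * M), pairEnergy R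
      (samplePath (unitSegment (fun t => B t η) k),
        samplePath (unitSegment (fun t => B t η) (k + 1 : ℕ))))) P := by
    refine .of_bound (((Finset.aemeasurable_fun_sum _ fun k _ =>
      hpair k).const_mul c).exp.aestronglyMeasurable)
      (Real.exp (c * ∑ k ∈ Finset.range (2 * M), 3 / 2 * K)) (.of_forall fun η => ?_)
    rw [Real.norm_of_nonneg (Real.exp_pos _).le]
    exact Real.exp_le_exp.2 (mul_le_mul_of_nonneg_left
      (Finset.sum_le_sum fun k _ => pairEnergy_le hR _) hc)
  have hlog : Real.log (∫ η, Real.exp (c / 2 * selfInteraction R T fun t => B t η) ∂P) ≤ _ :=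
    Real.log_le_log (integral_exp_pos (integrable_exp_selfInteraction hR hB hT (by positivity)))
      (integral_mono_ae (integrable_exp_selfInteraction hR hB hT (by positivity)) hint
      (hB.ae_continuous.mono fun η hη => Real.exp_le_exp.2 (by
        have h := (selfInteraction_mono hR hη hTM).trans (selfInteraction_two_mul_le hR hη M)
        nlinarith [mul_le_mul_of_nonneg_left h hc])))
  have hpos : 0 ≤ leadingConst R 1 B P := (leadingConst_pos hR hB one_ne_zero).le
  exact hlog.trans (hiid.trans (mul_le_mul_of_nonneg_right hMT (by positivity)))

/-- After Jensen, `T` is lowered to `N = ⌊T⌋`. From `N ≥ T - 1` and `N - 1 ≥ T - 2` the loss is at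
most `c (a/2 + 2b) ≤ 5/2 · c K`, rounded up to `3 c K`. -/
theorem le_logMoment (hR : IsInteractionKernel R K) (hB : IsPlanarBrownian B P) {T c : ℝ}
    (hT : 0 ≤ T) (hc : 0 ≤ c) :
    c * (T * leadingConst R 1 B P) - 3 * c * K ≤
      Real.log (∫ η, Real.exp (c / 2 * selfInteraction R T fun t => B t η) ∂P) := by
  set N := ⌊T⌋₊
  have hjensen := integral_le_log_integral_exp
    ((integrable_selfInteraction hR hB hT).const_mul (c / 2))
    (integrable_exp_selfInteraction hR hB hT (by positivity))
  refine le_trans ?_ hjensen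
  have hmono : ∫ η, selfInteraction R N (fun t => B t η) ∂P ≤
      ∫ η, selfInteraction R T (fun t => B t η) ∂P :=
    integral_mono_ae (integrable_selfInteraction hR hB N.cast_nonneg)
      (integrable_selfInteraction hR hB hT)
      (hB.ae_continuous.mono fun η hη => selfInteraction_mono hR hη (Nat.floor_le hT))
  rw [integral_selfInteraction_natCast hR hB] at hmono
  rw [integral_const_mul, leadingConst]
  have ha := (integral_selfInteraction_one_pos hR hB).le
  have ha' := selfMean_le (P := P) (B := B) hR
  have hb := neighbourMean_nonneg (P := P) (B := B) hR
  have hb' := neighbourMean_le hR hB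
  set a := ∫ η, selfInteraction R 1 (fun t => B t η) ∂P
  set b := ∫ η₁, ∫ η₂, neighbourInteraction R (fun t => B t η₁) (fun t => B t η₂) ∂P ∂P
  have hN : T - 1 ≤ N := by linarith [Nat.lt_floor_add_one T]
  have hN' : T - 2 ≤ (N - 1 : ℕ) := by
    have : N ≤ N - 1 + 1 := Nat.le_add_of_sub_le le_rfl
    have : (N : ℝ) ≤ (N - 1 : ℕ) + 1 := by exact_mod_cast this
    linarith
  have h1 := mul_le_mul_of_nonneg_right hN ha
  have h2 := mul_le_mul_of_nonneg_right hN' hb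
  have h3 : T * (a / 2 + b) - 3 * K ≤
      1 / 2 * ∫ η, selfInteraction R T (fun t => B t η) ∂P := by linarith [hR.bound_nonneg]
  linarith [mul_le_mul_of_nonneg_left h3 hc]

/-- The free energy is linear in time, with an error that is quadratic in the coupling per unit
time, and linear in the coupling at the boundary. -/
theorem abs_logMoment_sub_le (hR : IsInteractionKernel R K) (hB : IsPlanarBrownian B P)
    {T c c' : ℝ} (hT : 0 ≤ T) (hc : 0 ≤ c) (hcc' : c ≤ c') :
    |Real.log (∫ η, Real.exp (c / 2 * selfInteraction R T fun t => B t η) ∂P) -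
        c * (T * leadingConst R 1 B P)| ≤
      (3 * c' * K) ^ 2 * Real.exp (3 * c' * K) / 2 * T +
        (3 * c' * K + (3 * c' * K) ^ 2 * Real.exp (3 * c' * K)) := by
  have hK := hR.bound_nonneg
  have hlow := le_logMoment hR hB hT hc
  have hup := logMoment_le hR hB hT hc
  -- In the upper bound, rounding `T` costs an extra `2 c m`, which this makes at most `3 c K`.
  have hm : leadingConst R 1 B P ≤ 3 / 2 * K := by
    rw [leadingConst]
    linarith [selfMean_le (P := P) (B := B) hR, neighbourMean_le hR hB]
  have hd : 3 * c * K ≤ 3 * c' * K := by gcongr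
  have hq : (3 * c * K) ^ 2 * Real.exp (3 * c * K) ≤
      (3 * c' * K) ^ 2 * Real.exp (3 * c' * K) := by gcongr
  set q := (3 * c * K) ^ 2 * Real.exp (3 * c * K)
  set q' := (3 * c' * K) ^ 2 * Real.exp (3 * c' * K)
  have hq0 : 0 ≤ q' := by positivity
  have hqT := mul_le_mul_of_nonneg_left hq (by positivity : 0 ≤ T / 2)
  have hqT0 := mul_nonneg (by positivity : 0 ≤ T / 2) hq0
  have hcm := mul_le_mul_of_nonneg_left hm hc
  rw [abs_le]
  constructor
  · linarith
  · linarith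

end FreeEnergy

/-! ### The asymptotics with uniform errors. -/

theorem lemmaD1
    (φ : ℝ → ℝ) (ψ : Plane → ℝ)
    (hφ_smooth : ContDiff ℝ ∞ φ) (hφ_nonneg : ∀ s, 0 ≤ φ s) (hφ_ne : φ ≠ 0)
    (hφ_supp : Function.support φ ⊆ Icc 0 1)
    (hψ_smooth : ContDiff ℝ ∞ ψ) (hψ_nonneg : ∀ x, 0 ≤ ψ x) (hψ_ne : ψ ≠ 0)
    (hψ_symm : ∀ x, ψ (-x) = ψ x)
    (hψ_supp : Function.support ψ ⊆ Metric.closedBall 0 (1 / 2))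
    (M : ℝ) :
    ∃ δ : ℝ → ℝ, Tendsto δ (𝓝[>] 0) (𝓝 0) ∧
      ∀ (Ω : Type*) [MeasurableSpace Ω] (P : Measure Ω) [IsProbabilityMeasure P]
        (B : ℝ≥0 → Ω → Plane), IsPlanarBrownian B P →
      ∀ β : ℝ, 0 < β → β ≤ M →
        0 < leadingConst (noiseCorr φ ψ) β B P ∧
        ∀ t : ℝ, 0 < t → ∃ o₁ o₂ : ℝ → ℝ, ∀ ε : ℝ, 0 < ε → ε < 1 →
          |o₁ ε| ≤ δ ε ∧ |o₂ ε| ≤ δ ε ∧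
          zetaConst (noiseCorr φ ψ) β B P ε (t / ε ^ 2) =
            (leadingConst (noiseCorr φ ψ) β B P + o₁ ε) *
              (t / (ε ^ 2 * Real.log (1 / ε))) + o₂ ε := by
  obtain ⟨K, hR⟩ := exists_isInteractionKernel_noiseCorr hφ_smooth.continuous hφ_nonneg hφ_ne
    hφ_supp hψ_smooth.continuous hψ_nonneg hψ_ne hψ_symm hψ_supp
  have hK := hR.bound_nonneg
  -- These are the two errors of `abs_logMoment_sub_le` at the largest coupling `c' = M² l` with `l
  -- = 1 / log (1/ε)`. In `bulk` one factor `l` has been moved into `t / (ε² log (1/ε)) = l T`. Both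
  -- vanish at `l = 0`.
  set bulk : ℝ → ℝ := fun l =>
    (3 * M ^ 2 * K) ^ 2 * l * Real.exp (3 * (M ^ 2 * l) * K) / 2 with hbulk
  set boundary : ℝ → ℝ := fun l => 3 * (M ^ 2 * l) * K +
    (3 * (M ^ 2 * l) * K) ^ 2 * Real.exp (3 * (M ^ 2 * l) * K) with hboundary
  refine ⟨fun ε => bulk (Real.log (1 / ε))⁻¹ + boundary (Real.log (1 / ε))⁻¹, ?_, ?_⟩
  · have hl : Tendsto (fun ε : ℝ => (Real.log (1 / ε))⁻¹) (𝓝[>] 0) (𝓝 0) := by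
      simp only [one_div]
      exact (Real.tendsto_log_atTop.comp tendsto_inv_nhdsGT_zero).inv_tendsto_atTop
    have hF : Continuous fun l => bulk l + boundary l := by fun_prop
    have h0 : bulk 0 + boundary 0 = 0 := by simp [hbulk, hboundary]
    exact (h0 ▸ hF.tendsto 0).comp hl
  · intro Ω _ P _ B hB β hβ hβM
    refine ⟨leadingConst_pos hR hB hβ.ne', fun t ht => ?_⟩
    -- The errors are found for each `ε` separately and assembled by choice; outside `(0,1)` their
    -- value is immaterial.
    suffices H : ∀ ε : ℝ, ∃ o : ℝ × ℝ, 0 < ε → ε < 1 →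
        |o.1| ≤ bulk (Real.log (1 / ε))⁻¹ + boundary (Real.log (1 / ε))⁻¹ ∧
        |o.2| ≤ bulk (Real.log (1 / ε))⁻¹ + boundary (Real.log (1 / ε))⁻¹ ∧
        zetaConst (noiseCorr φ ψ) β B P ε (t / ε ^ 2) =
          (leadingConst (noiseCorr φ ψ) β B P + o.1) *
            (t / (ε ^ 2 * Real.log (1 / ε))) + o.2 by
      choose o ho using H
      exact ⟨fun ε => (o ε).1, fun ε => (o ε).2, ho⟩
    intro ε
    by_cases hε : 0 < ε ∧ ε < 1
    swap
    · exact ⟨0, fun h h' => absurd ⟨h, h'⟩ hε⟩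
    obtain ⟨hε0, hε1⟩ := hε
    have hL : 0 < Real.log (1 / ε) := Real.log_pos ((one_lt_div hε0).2 hε1)
    set L := Real.log (1 / ε) with hLdef
    have hT : 0 < t / ε ^ 2 := by positivity
    have hcc' : β ^ 2 * L⁻¹ ≤ M ^ 2 * L⁻¹ := by gcongr
    have key := abs_logMoment_sub_le hR hB hT.le (by positivity) hcc'
    have hA : 0 ≤ bulk L⁻¹ := by positivity
    have hD : 0 ≤ boundary L⁻¹ := by positivity
    obtain ⟨o₁, o₂, h1, h2, h3⟩ := exists_split_of_abs_le hA hD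
      (by positivity : 0 < t / (ε ^ 2 * L)) (key.trans_eq (by
        simp only [hbulk, hboundary]
        field_simp))
    refine ⟨(o₁, o₂), fun _ _ => ⟨by linarith, by linarith, ?_⟩⟩
    have hz : zetaConst (noiseCorr φ ψ) β B P ε (t / ε ^ 2) = Real.log (∫ η, Real.exp
        (β ^ 2 * L⁻¹ / 2 * selfInteraction (noiseCorr φ ψ) (t / ε ^ 2) fun t => B t η) ∂P) := by
      rw [zetaConst, ← hLdef, show β ^ 2 / (2 * L) = β ^ 2 * L⁻¹ / 2 by field_simp]
    rw [hz, leadingConst_eq, add_mul, add_assoc, ← h3]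
    field_simp
    ring
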